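/- An ultragraph $\mathcal G=(G^0,\mathcal G^1,r,s)$ consists of countable sets $G^0$ (vertices) and $\mathcal G^1$ (edges), a map $s:\mathcal G^1\to G^0$ and a map $r:\mathcal G^1\to P(G^0)\setminus\{\emptyset\}$. Let $\mathcal G^0$ be the smallest subset of $P(G^0)$ that contains all $\{v\}$, $v\in G^0$, and all $r(e)$, $e\in\mathcal G^1$, and is closed under finite unions and non-empty finite intersections. A path is a sequence $\alpha=e_1\cdots e_n$ of edges, $n\ge 1$, with $s(e_{i+1})\in r(e_i)$; put $s(\alpha)=s(e_1)$, $r(\alpha)=r(e_n)$, and let $W$ be the set of paths. Infinite paths are defined likewise. A sink is a vertex $v$ with $s^{-1}(v)=\emptyset$. Let $X$ be the set of all infinite paths, all pairs $(\alpha,v)$ with $\alpha\in W$ and $v\in r(\alpha)$ a sink, and all pairs $(v,v)$ with $v$ a sink; put $s(\alpha,v)=s(\alpha)$ and $s(v,v)=v$. For $a\in W$ and $y\in X$ with $s(y)\in r(a)$, let $ay\in X$ be the concatenation, with $a(\alpha,v)=(a\alpha,v)$ and $a(v,v)=(a,v)$. Let $\mathbb F$ be the free group on $\mathcal G^1$,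 with neutral element $0$. For $g\in\mathbb F$ whose reduced form is $ab^{-1}$ with $a,b\in W\cup\{0\}$, let $X_g=\{ay: y\in X,\ s(y)\in r(a)\cap r(b)\}$, where $r(0)=G^0$ and $0y=y$, and let $\theta_g:X_{g^{-1}}\to X_g$ be the bijection $by\mapsto ay$; for all other $g$ let $X_g=\emptyset$. Let $X_A=\{x\in X: s(x)\in A\}$ and $X_{bA}=\{by: y\in X,\ s(y)\in r(b)\cap A\}$ for $A\in\mathcal G^0$, $b\in W$. Let $R$ be a non-zero commutative unital ring. Write $1_A,1_{bA},1_c$ for the $R$-valued characteristic functions of $X_A,X_{bA},X_c$. Let $D$ be the (not necessarily unital) $R$-subalgebra of the algebra of all functions $X\to R$ that is generated by all $1_A$ and $1_{bA}$ ($A\in\mathcal G^0$, $b\in W$) and all $1_c$ ($c\in\mathbb F\setminus\{0\}$), and let $D_t$ be the ideal of $D$ generated, as an $R$-algebra, by the products of $1_t$ with these generators. The maps $\beta_t:D_{t^{-1}}\to D_t$, $\beta_t(f)=f\circ\theta_{t^{-1}}$ on $X_t$ and $0$ elsewhere, form a partial action of $\mathbb F$ on $D$. Its partial skew group ring $D\rtimes_\beta\mathbb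 F$ is the set of finite formal sums $\sum_t a_t\delta_t$ with $a_t\in D_t$, with componentwise addition and multiplication determined by $(a_t\delta_t)(b_s\delta_s)=\beta_t(\beta_{t^{-1}}(a_t)b_s)\delta_{ts}$. A subring $S$ of a ring is called maximal commutative if $S$ equals its centralizer. A cycle is a path $e_1\cdots e_n$, $n\ge 1$, with $s(e_1)\in r(e_n)$. An exit for it is an edge $e$ such that $s(e)\in r(e_i)$ and $e\ne e_{i+1}$ for some $i\in\{1,\dots,n\}$, where $e_{n+1}=e_1$. The ultragraph satisfies Condition (L) if for every cycle $e_1\cdots e_n$, the cycle has an exit or $r(e_i)$ contains a sink for some $i$. **Theorem.** $D\delta_0$ is a maximal commutative subring of $D\rtimes_\beta\mathbb F$ if and only if $\mathcal G$ satisfies Condition (L). -/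

import Mathlib

open scoped DirectSum

/-! ### Partial actions of groups on rings and partial skew group rings -/

/-- A partial action of a group `Γ` on a (not necessarily unital) ring `A`: two-sided ideals
`dom t` of `A` and ring isomorphisms `act t : dom t⁻¹ ≃+* dom t` such that `dom 1 = A`, `act 1` is
the identity, `act t (dom t⁻¹ ∩ dom s) = dom t ∩ dom (t * s)`, and `act t (act s x) = act (t * s) x`
for all `x ∈ dom s⁻¹ ∩ dom (s⁻¹ * t⁻¹)`. -/
structure PartialAction (Γ : Type*) (A : Type*) [Group Γ] [NonUnitalRing A] where
  dom : Γ → NonUnitalSubring A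
  mul_mem_left : ∀ (t : Γ) (a : A) {x : A}, x ∈ dom t → a * x ∈ dom t
  mul_mem_right : ∀ (t : Γ) (a : A) {x : A}, x ∈ dom t → x * a ∈ dom t
  act : ∀ t : Γ, dom t⁻¹ ≃+* dom t
  dom_one : dom 1 = ⊤
  act_one : ∀ x : dom 1⁻¹, (act 1 x : A) = x
  act_mem_iff : ∀ (t s : Γ) (x : dom t⁻¹), (act t x : A) ∈ dom (t * s) ↔ (x : A) ∈ dom s
  act_act : ∀ (t s : Γ) (x : dom s⁻¹) (y : dom t⁻¹) (z : dom (t * s)⁻¹),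
    (y : A) = act s x → (z : A) = x → (act t y : A) = act (t * s) z

namespace PartialAction

variable {Γ : Type*} {A : Type*} [Group Γ] [NonUnitalRing A] (α : PartialAction Γ A)

/-- The element `act t (act t⁻¹ a * b)` of `dom (t * s)`, for `a ∈ dom t` and `b ∈ dom s`; here
`act t⁻¹` is written as the inverse of `act t`. -/
def mulAux (t s : Γ) (a : α.dom t) (b : α.dom s) : α.dom (t * s) :=
  ⟨α.act t ⟨((α.act t).symm a : A) * b, α.mul_mem_right _ _ ((α.act t).symm a).2⟩,
    (α.act_mem_iff t s _).2 (α.mul_mem_left _ _ b.2)⟩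

/-- `mulAux` as a biadditive map. -/
def mulAuxHom (t s : Γ) : α.dom t →+ α.dom s →+ α.dom (t * s) :=
  AddMonoidHom.mk' (fun a => AddMonoidHom.mk' (fun b => α.mulAux t s a b) (by
      intro b c
      apply Subtype.ext
      change (α.act t _ : A) = ((α.act t _ + α.act t _ : α.dom t) : A)
      rw [← map_add]
      congr 2
      exact Subtype.ext (mul_add _ _ _))) (by
    intro a a'
    ext b
    change (α.act t _ : A) = ((α.act t _ + α.act t _ : α.dom t) : A)
    rw [← map_add]
    congr 2
    apply Subtype.ext
    change (((α.act t).symm (a + a') : α.dom t⁻¹) : A) * b = _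
    rw [map_add]
    exact add_mul _ _ _)

/-- The partial skew group ring: finite formal sums `∑ a_t δ_t` with `a_t ∈ dom t`. -/
def SkewGroupRing : Type _ := ⨁ t : Γ, α.dom t

noncomputable instance : AddCommGroup α.SkewGroupRing :=
  inferInstanceAs (AddCommGroup (⨁ t : Γ, α.dom t))

open Classical in
/-- The formal sum `a δ_t`. -/
noncomputable def single (t : Γ) : α.dom t →+ α.SkewGroupRing :=
  DirectSum.of (fun t : Γ => α.dom t) t

open Classical in
/-- The multiplication, biadditive and determined by
`(a δ_t) (b δ_s) = act t (act t⁻¹ a * b) δ_{t s}`. -/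
noncomputable def mulHom : α.SkewGroupRing →+ α.SkewGroupRing →+ α.SkewGroupRing :=
  DirectSum.toAddMonoid fun t => AddMonoidHom.flip <|
    DirectSum.toAddMonoid fun s => AddMonoidHom.flip <|
      (α.single (t * s)).compHom.comp (α.mulAuxHom t s)

noncomputable instance : NonUnitalNonAssocRing α.SkewGroupRing :=
  { (inferInstance : AddCommGroup α.SkewGroupRing) with
    mul := fun x y => α.mulHom x y
    left_distrib := fun x y z => map_add (α.mulHom x) y z
    right_distrib := fun x y z => by
      change α.mulHom (x + y) z = α.mulHom x z + α.mulHom y z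
      rw [map_add, AddMonoidHom.add_apply]
    zero_mul := fun x => by
      change α.mulHom 0 x = 0
      rw [map_zero, AddMonoidHom.zero_apply]
    mul_zero := fun x => map_zero (α.mulHom x) }

theorem single_mul_single (t s : Γ) (a : α.dom t) (b : α.dom s) :
    α.single t a * α.single s b = α.single (t * s) (α.mulAux t s a b) := by
  classical
  change α.mulHom (α.single t a) (α.single s b) = _
  have h1 : α.mulHom (α.single t a) = _ :=
    DirectSum.toAddMonoid_of (β := fun t => α.dom t) (γ := α.SkewGroupRing →+ α.SkewGroupRing) _ t a
  rw [h1]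
  exact congrArg (fun φ : α.dom t →+ α.SkewGroupRing => φ a)
    (DirectSum.toAddMonoid_of (β := fun t => α.dom t) (γ := α.dom t →+ α.SkewGroupRing)
      (fun s => AddMonoidHom.flip ((α.single (t * s)).compHom.comp (α.mulAuxHom t s))) s b)

theorem skew_induction {p : α.SkewGroupRing → Prop} (h0 : p 0)
    (hs : ∀ t a, p (α.single t a)) (ha : ∀ x y, p x → p y → p (x + y))
    (x : α.SkewGroupRing) : p x := by
  classical
  exact DirectSum.induction_on x h0 hs ha

/-- The copy `A δ_1` of `A` inside the partial skew group ring (recall that `dom 1 = A`). -/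
noncomputable def base : Set α.SkewGroupRing := Set.range (α.single 1)

end PartialAction

/-- A subset of a ring is maximal commutative if it equals its own centralizer. -/
def IsMaximalCommutative {M : Type*} [Mul M] (S : Set M) : Prop := Set.centralizer S = S

/-! ### Ultragraphs -/

/-- An ultragraph with vertex set `V` and edge set `E`. -/
structure Ultragraph (V : Type*) (E : Type*) where
  s : E → V
  r : E → Set V
  r_nonempty : ∀ e, (r e).Nonempty

/-- A pre-path: an infinite sequence of edges, or a finite sequence of edges and a vertex. -/
inductive PrePath (V : Type*) (E : Type*)
  | inf (ξ : Stream' E) : PrePath V E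
  | fin (α : List E) (v : V) : PrePath V E

/-- Concatenation `a x` of a finite sequence of edges with a pre-path. -/
def PrePath.concat {V E : Type*} (a : List E) : PrePath V E → PrePath V E
  | .inf ξ => .inf (a ++ₛ ξ)
  | .fin α v => .fin (a ++ α) v

namespace Ultragraph

variable {V : Type*} {E : Type*} (G : Ultragraph V E)

/-- The collection `𝒢⁰` of generalized vertices: the smallest collection of sets of vertices that
contains the singletons and the ranges of edges, and is closed under finite unions and under
intersections of finitely many (at least one) members. -/
inductive IsGenVertex : Set V → Prop
  | empty : IsGenVertex ∅
  | singleton (v : V) : IsGenVertex {v}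
  | range (e : E) : IsGenVertex (G.r e)
  | union {A B : Set V} : IsGenVertex A → IsGenVertex B → IsGenVertex (A ∪ B)
  | inter {A B : Set V} : IsGenVertex A → IsGenVertex B → IsGenVertex (A ∩ B)

/-- A sink is a vertex that emits no edge. -/
def IsSink (v : V) : Prop := ∀ e, G.s e ≠ v

/-- A finite sequence of edges with `s(e_{i+1}) ∈ r(e_i)`; the empty sequence is allowed. -/
def IsPath (α : List E) : Prop := α.IsChain fun e f => G.s f ∈ G.r e

/-- The range of a finite sequence of edges; the empty sequence imposes no condition. -/
def rng (α : List E) : Set V :=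
  match α.getLast? with
  | none => Set.univ
  | some e => G.r e

/-- The first vertex of a pre-path. -/
def src : PrePath V E → V
  | .inf ξ => G.s (ξ 0)
  | .fin [] v => v
  | .fin (e :: _) _ => G.s e

/-- Membership in the boundary path space: infinite paths, and pairs `(α, v)` of a path `α` and
a sink `v ∈ r(α)`. The pair `(v, v)`, for a sink `v`, is represented by the empty sequence and
`v`. -/
def IsBoundary : PrePath V E → Prop
  | .inf ξ => ∀ n, G.s (ξ (n + 1)) ∈ G.r (ξ n)
  | .fin α v => G.IsPath α ∧ G.IsSink v ∧ v ∈ G.rng α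

/-- The boundary path space `X`. -/
def X : Type _ := {x : PrePath V E // G.IsBoundary x}

/-- A cycle is a path `e_1 ⋯ e_n`, `n ≥ 1`, with `s(e_1) ∈ r(e_n)`. -/
def IsCycle (α : List E) : Prop :=
  G.IsPath α ∧ ∃ h : α ≠ [], G.s (α.head h) ∈ G.r (α.getLast h)

/-- An exit for a cycle `e_1 ⋯ e_n` is an edge `e` with `s(e) ∈ r(e_i)` and `e ≠ e_{i+1}` for
some `i`, where `e_{n+1} = e_1`. -/
def HasExit (α : List E) : Prop :=
  ∃ (i : ℕ) (hi : i < α.length) (e : E),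
    G.s e ∈ G.r α[i] ∧ e ≠ α[(i + 1) % α.length]'(Nat.mod_lt _ (Nat.zero_lt_of_lt hi))

/-- Condition (L): every cycle has an exit or passes through a range that contains a sink. -/
def ConditionL : Prop :=
  ∀ α : List E, G.IsCycle α → G.HasExit α ∨ ∃ e ∈ α, ∃ v ∈ G.r e, G.IsSink v

/-! ### The partial action of the free group on the boundary path space -/

/-- The element of the free group on the edges given by a finite sequence of edges. -/
def word (a : List E) : FreeGroup E := (a.map FreeGroup.of).prod

/-- `(a, b)` is a presentation of `g`: `a`, `b` are (possibly empty) paths, `g = a b⁻¹`, and this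
product is reduced, that is, `a` and `b` do not end in the same edge. -/
def Presents (g : FreeGroup E) (a b : List E) : Prop :=
  G.IsPath a ∧ G.IsPath b ∧ (∀ e, a.getLast? = some e → b.getLast? ≠ some e) ∧
    word a * (word b)⁻¹ = g

/-- The set `X_g`. If `g = a b⁻¹` (reduced, with `a`, `b` paths, possibly empty) it consists of
all `a y ∈ X` with `y ∈ X` and `s(y) ∈ r(a) ∩ r(b)`; it is empty for all other `g`. -/
def cyl (g : FreeGroup E) : Set G.X :=
  {x | ∃ a b, G.Presents g a b ∧
    ∃ y : G.X, G.src y.1 ∈ G.rng a ∩ G.rng b ∧ x.1 = y.1.concat a}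

/-- The set `X_A` of all `x ∈ X` with `s(x) ∈ A`. -/
def vcyl (A : Set V) : Set G.X := {x | G.src x.1 ∈ A}

/-- The set `X_{bA}` of all `b y ∈ X` with `y ∈ X` and `s(y) ∈ A`. -/
def pcyl (b : List E) (A : Set V) : Set G.X :=
  {x | ∃ y : G.X, G.src y.1 ∈ A ∧ x.1 = y.1.concat b}

/-- The graph of `θ_g`: if `g = a b⁻¹` (reduced) then `θ_g (b y) = a y`. -/
def Moves (g : FreeGroup E) (x x' : G.X) : Prop :=
  ∃ a b, G.Presents g a b ∧ ∃ y : G.X, x.1 = y.1.concat b ∧ x'.1 = y.1.concat a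

end Ultragraph

namespace PrePath

variable {V : Type*} {E : Type*}

theorem concat_nil (x : PrePath V E) : x.concat [] = x := by
  cases x <;> simp [concat]

theorem concat_append (a b : List E) (x : PrePath V E) :
    x.concat (a ++ b) = (x.concat b).concat a := by
  cases x <;> simp [concat]

theorem concat_inj {a : List E} {x y : PrePath V E} (h : x.concat a = y.concat a) : x = y := by
  cases x with
  | inf ξ =>
    cases y with
    | inf η =>
      simp only [concat, inf.injEq] at h
      have := congrArg (Stream'.drop a.length) h
      simpa [Stream'.drop_append_stream] using this
    | fin β w => simp [concat] at h
  | fin α v =>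
    cases y with
    | inf η => simp [concat] at h
    | fin β w => simpa [concat] using h

theorem concat_cons_inj {e f : E} {x y : PrePath V E} (h : x.concat [e] = y.concat [f]) :
    e = f ∧ x = y := by
  have he : e = f := by
    cases x with
    | inf ξ =>
      cases y with
      | inf η =>
        simp only [concat, inf.injEq] at h
        exact congrArg Stream'.head h
      | fin β w => simp [concat] at h
    | fin α v =>
      cases y with
      | inf η => simp [concat] at h
      | fin β w => simp [concat] at h; exact h.1.1
  subst he
  exact ⟨rfl, concat_inj h⟩

theorem concat_comparable {a b : List E} {x y : PrePath V E} (h : x.concat a = y.concat b) :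
    (∃ c, b = a ++ c ∧ x = y.concat c) ∨ (∃ c, a = b ++ c ∧ y = x.concat c) := by
  induction a generalizing b with
  | nil => exact Or.inl ⟨b, rfl, by rwa [concat_nil] at h⟩
  | cons e a ih =>
    cases b with
    | nil => exact Or.inr ⟨e :: a, rfl, by rw [concat_nil] at h; exact h.symm⟩
    | cons f b =>
      rw [← List.singleton_append, ← List.singleton_append (x := f), concat_append,
        concat_append] at h
      obtain ⟨rfl, h'⟩ := concat_cons_inj h
      rcases ih h' with ⟨c, rfl, hc⟩ | ⟨c, rfl, hc⟩
      · exact Or.inl ⟨c, rfl, hc⟩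
      · exact Or.inr ⟨c, rfl, hc⟩

end PrePath

namespace Ultragraph

variable {V : Type*} {E : Type*} (G : Ultragraph V E)

theorem src_concat_cons (e : E) (a : List E) (x : PrePath V E) :
    G.src (x.concat (e :: a)) = G.s e := by
  cases x <;> rfl

theorem isBoundary_concat_singleton (e : E) (x : PrePath V E) :
    G.IsBoundary (x.concat [e]) ↔ G.src x ∈ G.r e ∧ G.IsBoundary x := by
  cases x with
  | inf ξ =>
    simp only [PrePath.concat, IsBoundary, src]
    constructor
    · intro h
      exact ⟨h 0, fun n => h (n + 1)⟩
    · rintro ⟨h0, h⟩ n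
      cases n with
      | zero => exact h0
      | succ n => exact h n
  | fin α v =>
    cases α with
    | nil => simp [PrePath.concat, IsBoundary, src, IsPath, rng, and_comm]
    | cons f α =>
      simp [PrePath.concat, IsBoundary, src, IsPath, rng, List.getLast?_cons_cons, and_assoc]

theorem rng_cons_cons (e f : E) (a : List E) : G.rng (e :: f :: a) = G.rng (f :: a) := by
  simp [rng, List.getLast?_cons_cons]

theorem isBoundary_concat (a : List E) (x : PrePath V E) :
    G.IsBoundary (x.concat a) ↔ G.IsPath a ∧ G.src x ∈ G.rng a ∧ G.IsBoundary x := by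
  induction a with
  | nil => simp [PrePath.concat_nil, IsPath, rng]
  | cons e a ih =>
    rw [← List.singleton_append, PrePath.concat_append, isBoundary_concat_singleton, ih]
    cases a with
    | nil => simp [PrePath.concat_nil, IsPath, rng]
    | cons f a =>
      rw [src_concat_cons, List.singleton_append, rng_cons_cons]
      simp [IsPath, and_assoc]

theorem word_append (a b : List E) : word (a ++ b) = word a * word b := by
  simp [word]

theorem word_nil : word ([] : List E) = 1 := rfl

theorem word_eq_mk (a : List E) : word a = FreeGroup.mk (a.map fun e => (e, true)) := by
  induction a with
  | nil => rfl
  | cons e a ih =>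
    have : word (e :: a) = FreeGroup.of e * word a := by simp [word]
    rw [this, ih, FreeGroup.of, FreeGroup.mul_mk]
    rfl

theorem isReduced_aux {a b : List E} (h : ∀ e, a.getLast? = some e → b.getLast? ≠ some e) :
    FreeGroup.IsReduced (a.map (fun e => (e, true)) ++ b.reverse.map (fun e => (e, false))) := by
  unfold FreeGroup.IsReduced
  rw [List.isChain_append]
  refine ⟨?_, ?_, ?_⟩
  · rw [List.isChain_map]
    induction a using List.twoStepInduction <;> simp_all [List.isChain_iff_getElem]
  · rw [List.isChain_map]
    simp [List.isChain_iff_getElem]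
  · intro x hx y hy hxy
    simp only [List.getLast?_map, Option.mem_def, Option.map_eq_some_iff] at hx
    simp only [List.head?_map, List.head?_reverse, Option.mem_def, Option.map_eq_some_iff] at hy
    obtain ⟨e, he, rfl⟩ := hx
    obtain ⟨f, hf, rfl⟩ := hy
    simp only at hxy
    subst hxy
    exact absurd hf (h e he)

theorem word_mul_inv_eq_mk (a b : List E) : word a * (word b)⁻¹ =
    FreeGroup.mk (a.map (fun e => (e, true)) ++ b.reverse.map (fun e => (e, false))) := by
  rw [word_eq_mk, word_eq_mk, FreeGroup.inv_mk, FreeGroup.mul_mk]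
  simp [FreeGroup.invRev, Function.comp_def]

theorem filterMap_aux (a b : List E) (t : Bool) :
    (a.map (fun e => (e, true)) ++ b.reverse.map (fun e => (e, false))).filterMap
      (fun p => if p.2 = t then some p.1 else none) = if t then a else b.reverse := by
  cases t <;> simp [List.filterMap_map]

theorem Presents.unique {g : FreeGroup E} {a b a' b' : List E} (h : G.Presents g a b)
    (h' : G.Presents g a' b') : a = a' ∧ b = b' := by
  classical
  have key := h.2.2.2.trans h'.2.2.2.symm
  rw [word_mul_inv_eq_mk, word_mul_inv_eq_mk] at key
  have key := congrArg FreeGroup.toWord key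
  rw [FreeGroup.toWord_mk, FreeGroup.toWord_mk, (isReduced_aux h.2.2.1).reduce_eq,
    (isReduced_aux h'.2.2.1).reduce_eq] at key
  have h1 := filterMap_aux a b true
  have h2 := filterMap_aux a b false
  rw [key, filterMap_aux] at h1 h2
  simp at h1 h2
  exact ⟨h1.symm, h2.symm⟩

theorem word_injective : Function.Injective (word : List E → FreeGroup E) := by
  classical
  intro a b h
  rw [← mul_one (word a), ← mul_one (word b), ← inv_one, ← word_nil, word_mul_inv_eq_mk,
    word_mul_inv_eq_mk] at h
  have key := congrArg FreeGroup.toWord h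
  rw [FreeGroup.toWord_mk, FreeGroup.toWord_mk, (isReduced_aux (by simp)).reduce_eq,
    (isReduced_aux (by simp)).reduce_eq] at key
  have h1 := filterMap_aux a [] true
  rw [key, filterMap_aux] at h1
  simpa using h1.symm

/-- Dropping the requirement that `a b⁻¹` be reduced does not change the relation `Moves`. -/
theorem moves_iff {g : FreeGroup E} {x x' : G.X} : G.Moves g x x' ↔
    ∃ a b, ∃ y : G.X, word a * (word b)⁻¹ = g ∧ x.1 = y.1.concat b ∧ x'.1 = y.1.concat a := by
  constructor
  · rintro ⟨a, b, h, y, hb, ha⟩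
    exact ⟨a, b, y, h.2.2.2, hb, ha⟩
  · rintro ⟨a, b, y, h, hb, ha⟩
    induction a using List.reverseRecOn generalizing b y with
    | nil =>
      have pb := ((G.isBoundary_concat b y.1).1 (hb ▸ x.2)).1
      exact ⟨[], b, ⟨List.isChain_nil, pb, by simp, h⟩, y, hb, ha⟩
    | append_singleton a e ih =>
      have pb := ((G.isBoundary_concat b y.1).1 (hb ▸ x.2)).1
      have pa := ((G.isBoundary_concat (a ++ [e]) y.1).1 (ha ▸ x'.2))
      by_cases hl : b.getLast? = some e
      · obtain ⟨b, rfl⟩ := List.getLast?_eq_some_iff.1 hl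
        have pz := x'.2
        rw [ha, PrePath.concat_append] at pz
        refine ih b ⟨y.1.concat [e], ((G.isBoundary_concat _ _).1 pz).2.2⟩ ?_ ?_ ?_
        · rw [← h, word_append, word_append]; group
        · rw [hb, PrePath.concat_append]
        · rw [ha, PrePath.concat_append]
      · refine ⟨a ++ [e], b, ⟨pa.1, pb, ?_, h⟩, y, hb, ha⟩
        intro f hf
        simp at hf
        subst hf
        exact hl

theorem Moves.symm {g : FreeGroup E} {x x' : G.X} (h : G.Moves g x x') : G.Moves g⁻¹ x' x := by
  obtain ⟨a, b, y, rfl, hb, ha⟩ := G.moves_iff.1 h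
  exact G.moves_iff.2 ⟨b, a, y, by simp, ha, hb⟩

theorem moves_one {x x' : G.X} : G.Moves 1 x x' ↔ x' = x := by
  constructor
  · intro h
    obtain ⟨a, b, y, h, hb, ha⟩ := G.moves_iff.1 h
    rw [mul_inv_eq_one] at h
    rw [word_injective h] at ha
    exact Subtype.ext (ha.trans hb.symm)
  · rintro rfl
    exact G.moves_iff.2 ⟨[], [], x', by simp, (PrePath.concat_nil _).symm,
      (PrePath.concat_nil _).symm⟩

theorem Moves.trans {g h : FreeGroup E} {x x' x'' : G.X} (h1 : G.Moves h x x')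
    (h2 : G.Moves g x' x'') : G.Moves (g * h) x x'' := by
  obtain ⟨a, b, y, rfl, hb, ha⟩ := G.moves_iff.1 h1
  obtain ⟨d, c, z, rfl, hc, hd⟩ := G.moves_iff.1 h2
  rcases PrePath.concat_comparable (ha.symm.trans hc) with ⟨w, rfl, hw⟩ | ⟨w, rfl, hw⟩
  · refine G.moves_iff.2 ⟨d, b ++ w, z, ?_, ?_, hd⟩
    · rw [word_append, word_append]; group
    · rw [hb, hw, PrePath.concat_append]
  · refine G.moves_iff.2 ⟨d ++ w, b, y, ?_, hb, ?_⟩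
    · rw [word_append, word_append]; group
    · rw [hd, hw, PrePath.concat_append]

theorem Moves.functional {g : FreeGroup E} {x x' x'' : G.X} (h1 : G.Moves g x x')
    (h2 : G.Moves g x x'') : x'' = x' := by
  have := h1.symm.trans G h2
  rwa [mul_inv_cancel, moves_one] at this

theorem moves_word {b : List E} {x x' : G.X} : G.Moves (word b) x x' ↔ x'.1 = x.1.concat b := by
  constructor
  · intro h
    obtain ⟨a, c, y, h, hc, ha⟩ := G.moves_iff.1 h
    rw [mul_inv_eq_iff_eq_mul, ← word_append] at h
    rw [ha, word_injective h, hc, PrePath.concat_append]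
  · intro h
    exact G.moves_iff.2 ⟨b, [], x, by simp [word_nil], (PrePath.concat_nil _).symm, h⟩

theorem mem_cyl_iff {g : FreeGroup E} {x : G.X} : x ∈ G.cyl g ↔ ∃ y, G.Moves g y x := by
  constructor
  · rintro ⟨a, b, h, y, hy, hx⟩
    exact ⟨⟨y.1.concat b, (G.isBoundary_concat _ _).2 ⟨h.2.1, hy.2, y.2⟩⟩, a, b, h, y, rfl, hx⟩
  · rintro ⟨z, a, b, h, y, hz, hx⟩
    exact ⟨a, b, h, y, ⟨((G.isBoundary_concat _ _).1 (hx ▸ x.2)).2.1,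
      ((G.isBoundary_concat _ _).1 (hz ▸ z.2)).2.1⟩, hx⟩

theorem mem_cyl_inv_iff {g : FreeGroup E} {x : G.X} : x ∈ G.cyl g⁻¹ ↔ ∃ y, G.Moves g x y := by
  rw [mem_cyl_iff]
  constructor
  · rintro ⟨y, h⟩
    exact ⟨y, by simpa using h.symm⟩
  · rintro ⟨y, h⟩
    exact ⟨y, h.symm⟩

open Classical in
/-- The underlying function of `θ_g`, extended by the identity outside `X_{g⁻¹}`. -/
noncomputable def thetaFun (g : FreeGroup E) (x : G.X) : G.X :=
  if h : ∃ x', G.Moves g x x' then h.choose else x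

theorem Moves.thetaFun_eq {g : FreeGroup E} {x x' : G.X} (h : G.Moves g x x') :
    G.thetaFun g x = x' := by
  have h' : ∃ x', G.Moves g x x' := ⟨x', h⟩
  rw [thetaFun, dif_pos h']
  exact h.functional G h'.choose_spec

/-- The partial action `θ` of the free group on `X`: the bijection `θ_g : X_{g⁻¹} → X_g`. -/
noncomputable def theta (g : FreeGroup E) : PartialEquiv G.X G.X where
  toFun := G.thetaFun g
  invFun := G.thetaFun g⁻¹
  source := G.cyl g⁻¹
  target := G.cyl g
  map_source' := by
    intro x hx
    obtain ⟨y, hy⟩ := G.mem_cyl_inv_iff.1 hx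
    rw [hy.thetaFun_eq]
    exact G.mem_cyl_iff.2 ⟨x, hy⟩
  map_target' := by
    intro x hx
    obtain ⟨y, hy⟩ := G.mem_cyl_iff.1 hx
    rw [hy.symm.thetaFun_eq]
    exact G.mem_cyl_inv_iff.2 ⟨x, hy⟩
  left_inv' := by
    intro x hx
    obtain ⟨y, hy⟩ := G.mem_cyl_inv_iff.1 hx
    rw [hy.thetaFun_eq, hy.symm.thetaFun_eq]
  right_inv' := by
    intro x hx
    obtain ⟨y, hy⟩ := G.mem_cyl_iff.1 hx
    rw [hy.symm.thetaFun_eq, hy.thetaFun_eq]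

theorem theta_eq {g : FreeGroup E} {x x' : G.X} (h : G.Moves g x x') : G.theta g x = x' :=
  h.thetaFun_eq

end Ultragraph

/-! ### The algebra `D`, its ideals `D_t`, and the partial action `β` -/

namespace Ultragraph

variable {V : Type*} {E : Type*} (G : Ultragraph V E) (R : Type*) [CommRing R]

/-- The characteristic function of a set of boundary paths, with values in `R`. -/
noncomputable def char (S : Set G.X) : G.X → R := S.indicator 1

/-- The generators `1_A`, `1_{bA}` and `1_c` (`c ≠ 1`) of the algebra `D`. -/
inductive IsGenerator : (G.X → R) → Prop
  | vertex {A : Set V} : G.IsGenVertex A → IsGenerator (G.char R (G.vcyl A))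
  | path {b : List E} {A : Set V} : b ≠ [] → G.IsPath b → G.IsGenVertex A →
      IsGenerator (G.char R (G.pcyl b A))
  | group {c : FreeGroup E} : c ≠ 1 → IsGenerator (G.char R (G.cyl c))

/-- The `R`-subalgebra `D` of the algebra of all functions `X → R` (with pointwise operations)
generated by the characteristic functions `1_A`, `1_{bA}` and `1_c`, `c ≠ 1`. -/
noncomputable def D : NonUnitalSubalgebra R (G.X → R) :=
  NonUnitalAlgebra.adjoin R {f | G.IsGenerator R f}

/-- The ideal `D_t` of `D`: the subalgebra generated by the products of `1_t` with the generators
of `D`. -/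
noncomputable def Dt (t : FreeGroup E) : NonUnitalSubalgebra R (G.D R) :=
  NonUnitalAlgebra.adjoin R
    {f | ∃ g, G.IsGenerator R g ∧ (f : G.X → R) = G.char R (G.cyl t) * g}

/-- The function `f ∘ θ_{t⁻¹}` on `X_t`, extended by zero. -/
noncomputable def betaFun (t : FreeGroup E) (f : G.X → R) : G.X → R :=
  (G.cyl t).indicator (f ∘ G.theta t⁻¹)

variable {R}

theorem char_apply_mem {S : Set G.X} {x : G.X} (h : x ∈ S) : G.char R S x = 1 := by
  simp [char, h]

theorem char_apply_not_mem {S : Set G.X} {x : G.X} (h : x ∉ S) : G.char R S x = 0 := by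
  simp [char, h]

theorem char_inter (S T : Set G.X) : G.char R (S ∩ T) = G.char R S * G.char R T := by
  funext x
  by_cases hS : x ∈ S <;> by_cases hT : x ∈ T <;> simp [char, hS, hT]

theorem cyl_one : G.cyl 1 = Set.univ := by
  ext x
  simp only [Set.mem_univ, iff_true]
  exact G.mem_cyl_iff.2 ⟨x, G.moves_one.2 rfl⟩

theorem char_cyl_one : G.char R (G.cyl 1) = 1 := by
  rw [cyl_one, char, Set.indicator_univ]

theorem gen_mem {g : G.X → R} (h : G.IsGenerator R g) : g ∈ G.D R :=
  NonUnitalAlgebra.subset_adjoin R h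

theorem char_mul_mem (t : FreeGroup E) {f : G.X → R} (hf : f ∈ G.D R) :
    G.char R (G.cyl t) * f ∈ G.D R := by
  by_cases ht : t = 1
  · rw [ht, char_cyl_one, one_mul]
    exact hf
  · exact mul_mem (G.gen_mem (.group ht)) hf

theorem char_idem (S : Set G.X) : G.char R S * G.char R S = G.char R S := by
  rw [← char_inter, Set.inter_self]

theorem mul_mem_Dt (t : FreeGroup E) {f : G.X → R} (hf : f ∈ G.D R) :
    (⟨_, G.char_mul_mem t hf⟩ : G.D R) ∈ G.Dt R t := by
  unfold D at hf
  induction hf using NonUnitalAlgebra.adjoin_induction with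
  | mem g hg => exact NonUnitalAlgebra.subset_adjoin R ⟨g, hg, rfl⟩
  | add f g hf hg h1 h2 =>
    convert add_mem h1 h2 using 1
    exact Subtype.ext (mul_add _ _ _)
  | zero =>
    convert zero_mem (G.Dt R t) using 1
    exact Subtype.ext (mul_zero _)
  | mul f g hf hg h1 h2 =>
    convert mul_mem h1 h2 using 1
    apply Subtype.ext
    change _ = (G.char R (G.cyl t) * f) * (G.char R (G.cyl t) * g)
    rw [mul_mul_mul_comm, char_idem]
  | smul r f hf h =>
    convert SMulMemClass.smul_mem r h using 1
    exact Subtype.ext (mul_smul_comm _ _ _)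

/-- `D_t` consists of the elements of `D` that vanish outside `X_t`. -/
theorem mem_Dt_iff {t : FreeGroup E} {f : G.D R} :
    f ∈ G.Dt R t ↔ ∀ x, x ∉ G.cyl t → f.1 x = 0 := by
  constructor
  · intro hf
    unfold Dt at hf
    induction hf using NonUnitalAlgebra.adjoin_induction with
    | mem f hf =>
      obtain ⟨g, -, hg⟩ := hf
      intro x hx
      rw [hg, Pi.mul_apply, char_apply_not_mem G hx, zero_mul]
    | add f g hf hg h1 h2 =>
      intro x hx
      change f.1 x + g.1 x = 0
      rw [h1 x hx, h2 x hx, add_zero]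
    | zero => intro x hx; rfl
    | mul f g hf hg h1 h2 =>
      intro x hx
      change f.1 x * g.1 x = 0
      rw [h1 x hx, zero_mul]
    | smul r f hf h =>
      intro x hx
      change r • f.1 x = 0
      rw [h x hx, smul_zero]
  · intro h
    convert G.mul_mem_Dt t f.2 using 1
    apply Subtype.ext
    funext x
    change _ = (G.char R (G.cyl t) * f.1) x
    by_cases hx : x ∈ G.cyl t
    · rw [Pi.mul_apply, char_apply_mem G hx, one_mul]
    · rw [h x hx, Pi.mul_apply, char_apply_not_mem G hx, zero_mul]

theorem betaFun_apply {t : FreeGroup E} {f : G.X → R} {x y : G.X} (h : G.Moves t y x) :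
    G.betaFun R t f x = f y := by
  rw [betaFun, Set.indicator_of_mem (G.mem_cyl_iff.2 ⟨y, h⟩), Function.comp_apply,
    G.theta_eq h.symm]

theorem betaFun_apply_not_mem {t : FreeGroup E} {f : G.X → R} {x : G.X} (h : x ∉ G.cyl t) :
    G.betaFun R t f x = 0 := Set.indicator_of_notMem h _

theorem char_image_mem (g : FreeGroup E) {A : Set V} (hA : G.IsGenVertex A) :
    G.char R {x | ∃ y, G.Moves g y x ∧ G.src y.1 ∈ A} ∈ G.D R := by
  by_cases hg : ∃ a : List E, g = word a
  · obtain ⟨a, rfl⟩ := hg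
    have : {x | ∃ y, G.Moves (word a) y x ∧ G.src y.1 ∈ A} = G.pcyl a A := by
      ext x
      simp [moves_word, pcyl, and_comm]
    rw [this]
    by_cases ha : a = []
    · have : G.pcyl a A = G.vcyl A := by
        ext x
        subst ha
        simp only [pcyl, PrePath.concat_nil, Set.mem_ofPred_eq, vcyl]
        constructor
        · rintro ⟨y, hy, h⟩
          rwa [h]
        · intro h
          exact ⟨x, h, rfl⟩
      rw [this]
      exact G.gen_mem (.vertex hA)
    · by_cases hp : G.IsPath a
      · exact G.gen_mem (.path ha hp hA)
      · have : G.pcyl a A = ∅ := by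
          ext x
          simp only [pcyl, Set.mem_ofPred_eq, Set.mem_empty_iff_false, iff_false]
          rintro ⟨y, hy, h⟩
          exact hp ((G.isBoundary_concat a y.1).1 (h ▸ x.2)).1
        rw [this, char, Set.indicator_empty]
        exact zero_mem _
  · have hg1 : g ≠ 1 := fun h => hg ⟨[], h⟩
    by_cases hne : ∃ y x, G.Moves g y x ∧ G.src y.1 ∈ A
    · obtain ⟨y, x, ⟨a, b, hab, w, hb, ha⟩, hy⟩ := hne
      have : {x | ∃ y, G.Moves g y x ∧ G.src y.1 ∈ A} = G.cyl g := by
        ext x'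
        rw [mem_cyl_iff]
        constructor
        · rintro ⟨y', h, -⟩
          exact ⟨y', h⟩
        · rintro ⟨y', h⟩
          refine ⟨y', h, ?_⟩
          obtain ⟨a', b', hab', w', hb', ha'⟩ := h
          obtain ⟨rfl, rfl⟩ := hab.unique G hab'
          cases b with
          | nil => exact absurd ⟨a, by rw [← hab.2.2.2]; simp [word_nil]⟩ hg
          | cons e b =>
            rw [hb', src_concat_cons]
            rwa [hb, src_concat_cons] at hy
      rw [this]
      exact G.gen_mem (.group hg1)
    · have : {x | ∃ y, G.Moves g y x ∧ G.src y.1 ∈ A} = ∅ := by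
        ext x
        simp only [Set.mem_ofPred_eq, Set.mem_empty_iff_false, iff_false]
        rintro ⟨y, h⟩
        exact hne ⟨y, x, h⟩
      rw [this, char, Set.indicator_empty]
      exact zero_mem _

theorem betaFun_char (t : FreeGroup E) (S : Set G.X) :
    G.betaFun R t (G.char R S) = G.char R {x | ∃ y, G.Moves t y x ∧ y ∈ S} := by
  funext x
  by_cases hx : x ∈ G.cyl t
  · obtain ⟨y, hy⟩ := G.mem_cyl_iff.1 hx
    rw [betaFun_apply G hy]
    by_cases hS : y ∈ S
    · rw [char_apply_mem G hS, char_apply_mem]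
      exact ⟨y, hy, hS⟩
    · rw [char_apply_not_mem G hS, char_apply_not_mem]
      rintro ⟨z, hz, hzS⟩
      exact hS (by rwa [hz.symm.functional G hy.symm])
  · rw [betaFun_apply_not_mem G hx, char_apply_not_mem]
    rintro ⟨z, hz, hzS⟩
    exact hx (G.mem_cyl_iff.2 ⟨z, hz⟩)

theorem betaFun_mem (t : FreeGroup E) {f : G.X → R} (hf : f ∈ G.D R) :
    G.betaFun R t f ∈ G.D R := by
  unfold D at hf
  induction hf using NonUnitalAlgebra.adjoin_induction with
  | mem g hg =>
    cases hg with
    | vertex hA =>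
      rw [betaFun_char]
      exact G.char_image_mem t hA
    | @path b A hb hp hA =>
      rw [betaFun_char]
      have : {x | ∃ y, G.Moves t y x ∧ y ∈ G.pcyl b A} =
          G.cyl t ∩ {x | ∃ z, G.Moves (t * word b) z x ∧ G.src z.1 ∈ A} := by
        ext x
        simp only [Set.mem_inter_iff, Set.mem_ofPred_eq, mem_cyl_iff]
        constructor
        · rintro ⟨y, hy, z, hz, hyz⟩
          exact ⟨⟨y, hy⟩, z, (G.moves_word.2 hyz).trans G hy, hz⟩
        · rintro ⟨⟨y, hy⟩, z, hz, hzA⟩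
          refine ⟨y, hy, z, hzA, ?_⟩
          have := hz.trans G hy.symm
          rw [inv_mul_cancel_left] at this
          exact G.moves_word.1 this
      rw [this, char_inter]
      exact G.char_mul_mem t (G.char_image_mem _ hA)
    | @group c hc =>
      rw [betaFun_char]
      have : {x | ∃ y, G.Moves t y x ∧ y ∈ G.cyl c} = G.cyl t ∩ G.cyl (t * c) := by
        ext x
        simp only [Set.mem_inter_iff, Set.mem_ofPred_eq, mem_cyl_iff]
        constructor
        · rintro ⟨y, hy, z, hz⟩
          exact ⟨⟨y, hy⟩, z, hz.trans G hy⟩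
        · rintro ⟨⟨y, hy⟩, z, hz⟩
          refine ⟨y, hy, z, ?_⟩
          have := hz.trans G hy.symm
          rwa [inv_mul_cancel_left] at this
      rw [this]
      by_cases ht : t = 1
      · rw [ht, cyl_one, Set.univ_inter, one_mul]
        exact G.gen_mem (.group hc)
      · rw [Set.inter_comm, char_inter]
        exact G.char_mul_mem _ (G.gen_mem (.group ht))
  | add f g hf hg h1 h2 =>
    convert add_mem h1 h2 using 1
    exact Set.indicator_add _ _ _
  | zero =>
    convert zero_mem (G.D R) using 1
    exact Set.indicator_zero _ _
  | mul f g hf hg h1 h2 =>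
    convert mul_mem h1 h2 using 1
    exact Set.indicator_mul _ _ _
  | smul r f hf h =>
    convert SMulMemClass.smul_mem r h using 1
    exact Set.indicator_const_smul (G.cyl t) r (f ∘ G.theta t⁻¹)

theorem betaFun_betaFun (t : FreeGroup E) {f : G.X → R} (h : ∀ x, x ∉ G.cyl t → f x = 0) :
    G.betaFun R t (G.betaFun R t⁻¹ f) = f := by
  funext x
  by_cases hx : x ∈ G.cyl t
  · obtain ⟨y, hy⟩ := G.mem_cyl_iff.1 hx
    rw [betaFun_apply G hy, betaFun_apply G hy.symm]
  · rw [betaFun_apply_not_mem G hx, h x hx]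

theorem betaFun_mem_Dt (t : FreeGroup E) (f : G.D R) :
    (⟨_, G.betaFun_mem t f.2⟩ : G.D R) ∈ G.Dt R t :=
  G.mem_Dt_iff.2 fun _ hx => G.betaFun_apply_not_mem hx

variable (R)

/-- The isomorphism `β_t : D_{t⁻¹} → D_t`, `β_t(f) = f ∘ θ_{t⁻¹}` (on `X_t`, and `0` elsewhere). -/
noncomputable def beta (t : FreeGroup E) :
    (G.Dt R t⁻¹).toNonUnitalSubring ≃+* (G.Dt R t).toNonUnitalSubring where
  toFun f := ⟨⟨G.betaFun R t f.1.1, G.betaFun_mem t f.1.2⟩, G.betaFun_mem_Dt t f.1⟩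
  invFun f := ⟨⟨G.betaFun R t⁻¹ f.1.1, G.betaFun_mem t⁻¹ f.1.2⟩, G.betaFun_mem_Dt t⁻¹ f.1⟩
  left_inv f := Subtype.ext (Subtype.ext (by
    have := G.betaFun_betaFun t⁻¹ (G.mem_Dt_iff.1 f.2)
    rwa [inv_inv] at this))
  right_inv f := Subtype.ext (Subtype.ext (G.betaFun_betaFun t (G.mem_Dt_iff.1 f.2)))
  map_mul' f g := Subtype.ext (Subtype.ext (Set.indicator_mul _ _ _))
  map_add' f g := Subtype.ext (Subtype.ext (Set.indicator_add _ _ _))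

/-- The partial action `β` of the free group on the edges on the algebra `D`. -/
noncomputable def partialAction : PartialAction (FreeGroup E) (G.D R) where
  dom t := (G.Dt R t).toNonUnitalSubring
  mul_mem_left t a x hx := by
    refine G.mem_Dt_iff.2 fun y hy => ?_
    change a.1 y * x.1 y = 0
    rw [G.mem_Dt_iff.1 hx y hy, mul_zero]
  mul_mem_right t a x hx := by
    refine G.mem_Dt_iff.2 fun y hy => ?_
    change x.1 y * a.1 y = 0
    rw [G.mem_Dt_iff.1 hx y hy, zero_mul]
  act t := G.beta R t
  dom_one := by
    ext f
    simp only [NonUnitalSubring.mem_top, iff_true]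
    exact G.mem_Dt_iff.2 fun x hx => absurd (by rw [cyl_one]; trivial) hx
  act_one f := by
    apply Subtype.ext
    funext x
    exact G.betaFun_apply (G.moves_one.2 rfl)
  act_mem_iff t s f := by
    change _ ∈ G.Dt R (t * s) ↔ _ ∈ G.Dt R s
    rw [mem_Dt_iff, mem_Dt_iff]
    constructor
    · intro h x hx
      by_cases hxt : x ∈ G.cyl t⁻¹
      · obtain ⟨y, hy⟩ := G.mem_cyl_inv_iff.1 hxt
        refine (G.betaFun_apply hy).symm.trans (h y fun hys => hx ?_)
        obtain ⟨z, hz⟩ := G.mem_cyl_iff.1 hys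
        have := hz.trans G hy.symm
        rw [inv_mul_cancel_left] at this
        exact G.mem_cyl_iff.2 ⟨z, this⟩
      · exact G.mem_Dt_iff.1 f.2 x hxt
    · intro h x hx
      by_cases hxt : x ∈ G.cyl t
      · obtain ⟨y, hy⟩ := G.mem_cyl_iff.1 hxt
        refine (G.betaFun_apply hy).trans (h y fun hys => hx ?_)
        obtain ⟨z, hz⟩ := G.mem_cyl_iff.1 hys
        exact G.mem_cyl_iff.2 ⟨z, hz.trans G hy⟩
      · exact G.betaFun_apply_not_mem hxt
  act_act t s f g k hg hk := by
    apply Subtype.ext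
    funext x
    change G.betaFun R t g.1.1 x = G.betaFun R (t * s) k.1.1 x
    have hg' : ∀ y, g.1.1 y = G.betaFun R s f.1.1 y := fun y =>
      congrFun (congrArg Subtype.val hg) y
    by_cases hxt : x ∈ G.cyl t
    · obtain ⟨y, hy⟩ := G.mem_cyl_iff.1 hxt
      rw [G.betaFun_apply hy, hg']
      by_cases hys : y ∈ G.cyl s
      · obtain ⟨z, hz⟩ := G.mem_cyl_iff.1 hys
        rw [G.betaFun_apply hz, G.betaFun_apply (hz.trans G hy), hk]
      · rw [G.betaFun_apply_not_mem hys, G.betaFun_apply_not_mem]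
        intro hx
        obtain ⟨z, hz⟩ := G.mem_cyl_iff.1 hx
        have := hz.trans G hy.symm
        rw [inv_mul_cancel_left] at this
        exact hys (G.mem_cyl_iff.2 ⟨z, this⟩)
    · rw [G.betaFun_apply_not_mem hxt]
      by_cases hx : x ∈ G.cyl (t * s)
      · obtain ⟨z, hz⟩ := G.mem_cyl_iff.1 hx
        rw [G.betaFun_apply hz, hk]
        by_cases hzs : z ∈ G.cyl s⁻¹
        · obtain ⟨y, hy⟩ := G.mem_cyl_inv_iff.1 hzs
          have hgy := hg' y
          rw [G.betaFun_apply hy] at hgy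
          rw [← hgy]
          refine (G.mem_Dt_iff.1 g.2 y fun hyt => hxt ?_).symm
          have h1 := hy.symm.trans G hz
          rw [mul_inv_cancel_right] at h1
          exact G.mem_cyl_iff.2 ⟨y, h1⟩
        · exact (G.mem_Dt_iff.1 f.2 z hzs).symm
      · rw [G.betaFun_apply_not_mem hx]

/-- The partial skew group ring `D ⋊_β 𝔽`. -/
abbrev SkewRing : Type _ := (G.partialAction R).SkewGroupRing

variable {R}

theorem mulAux_apply {t s : FreeGroup E} (a : (G.partialAction R).dom t)
    (b : (G.partialAction R).dom s) {x y : G.X} (h : G.Moves t y x) :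
    ((G.partialAction R).mulAux t s a b).1.1 x = a.1.1 x * b.1.1 y := by
  have h1 : ((G.partialAction R).mulAux t s a b).1.1 x =
      G.betaFun R t (G.betaFun R t⁻¹ a.1.1 * b.1.1) x := rfl
  rw [h1, G.betaFun_apply h, Pi.mul_apply, G.betaFun_apply h.symm]

theorem mulAux_apply_not_mem {t s : FreeGroup E} (a : (G.partialAction R).dom t)
    (b : (G.partialAction R).dom s) {x : G.X} (h : x ∉ G.cyl t) :
    ((G.partialAction R).mulAux t s a b).1.1 x = 0 :=
  G.betaFun_apply_not_mem h

theorem single_congr {t t' : FreeGroup E} (ht : t = t') (a : (G.partialAction R).dom t)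
    (a' : (G.partialAction R).dom t') (h : ∀ x, a.1.1 x = a'.1.1 x) :
    (G.partialAction R).single t a = (G.partialAction R).single t' a' := by
  subst ht
  congr 1
  exact Subtype.ext (Subtype.ext (funext h))

theorem single_mul_assoc (t s u : FreeGroup E) (a : (G.partialAction R).dom t)
    (b : (G.partialAction R).dom s) (c : (G.partialAction R).dom u) :
    (G.partialAction R).single t a * (G.partialAction R).single s b *
        (G.partialAction R).single u c =
      (G.partialAction R).single t a * ((G.partialAction R).single s b *
        (G.partialAction R).single u c) := by
  simp only [PartialAction.single_mul_single]
  refine G.single_congr (mul_assoc t s u) _ _ fun x => ?_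
  by_cases hx : x ∈ G.cyl t
  · obtain ⟨y, hy⟩ := G.mem_cyl_iff.1 hx
    rw [G.mulAux_apply a _ hy]
    by_cases hys : y ∈ G.cyl s
    · obtain ⟨z, hz⟩ := G.mem_cyl_iff.1 hys
      rw [G.mulAux_apply _ c (hz.trans G hy), G.mulAux_apply a b hy, G.mulAux_apply b c hz,
        mul_assoc]
    · rw [G.mulAux_apply_not_mem b c hys, mul_zero, G.mulAux_apply_not_mem]
      intro h
      obtain ⟨z, hz⟩ := G.mem_cyl_iff.1 h
      have := hz.trans G hy.symm
      rw [inv_mul_cancel_left] at this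
      exact hys (G.mem_cyl_iff.2 ⟨z, this⟩)
  · rw [G.mulAux_apply_not_mem a _ hx]
    by_cases h : x ∈ G.cyl (t * s)
    · obtain ⟨z, hz⟩ := G.mem_cyl_iff.1 h
      rw [G.mulAux_apply _ c hz, G.mulAux_apply_not_mem a b hx, zero_mul]
    · exact G.mulAux_apply_not_mem _ c h

variable (R)

/-- `D ⋊_β 𝔽` is a ring: its multiplication is associative. -/
noncomputable instance : NonUnitalRing (G.SkewRing R) :=
  { (inferInstance : NonUnitalNonAssocRing (G.SkewRing R)) with
    mul_assoc := by
      intro x y z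
      induction x using (G.partialAction R).skew_induction with
      | h0 => simp only [zero_mul]
      | ha x x' h h' => simp only [add_mul, h, h']
      | hs t a =>
        induction y using (G.partialAction R).skew_induction with
        | h0 => simp only [zero_mul, mul_zero]
        | ha y y' h h' => simp only [add_mul, mul_add, h, h']
        | hs s b =>
          induction z using (G.partialAction R).skew_induction with
          | h0 => simp only [mul_zero]
          | ha z z' h h' => simp only [mul_add, h, h']
          | hs u c => exact G.single_mul_assoc t s u a b c }

/-- The subring `D δ_0` of `D ⋊_β 𝔽` (the `0` of the usual notation is the neutral element of the
free group, written `1` here). -/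
noncomputable abbrev Dδ : Set (G.SkewRing R) := (G.partialAction R).base

end Ultragraph

/-! The coefficients decide everything. `∑ a_t δ_t` commutes with `D δ_1` iff `a_t(u) f(u) = a_t(u)
f(θ_{t⁻¹} u)` for all `t`, all `u ∈ X_t` and all `f ∈ D` (`mem_centralizer_base_iff`). Since `D`
separates the points of `X` by functions with values `0` and `1` (`exists_mem_D_separating`), each
`a_t` then vanishes off the fixed points of `θ_t`. The question is thus whether some nonzero `a_t ∈
D_t` with `t ≠ 1` lives on fixed points only.

For `t ≠ 1`, `θ_t` has at most one fixed point, and it is eventually periodic, `u = b γ γ γ ⋯` with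
`γ` a cycle (`Moves.exists_of_fixed`). Elements of `D` are locally constant at infinite paths: their
value depends on a long enough initial segment (`exists_length_forall_eq`). If `a_t(u) ≠ 0`, then
`a_t` is nonzero at every boundary path sharing a long segment with `u`. Under Condition (L) an exit
or a sink supplies a second such path (`exists_ne_of_concat_eq_self`), which would be a second fixed
point.

Conversely, let `γ` be a cycle without exit whose ranges contain no sinks. Only `γ γ γ ⋯` can follow
`γ` (`eq_of_not_hasExit`), so `θ_γ` fixes its whole domain and `1_γ δ_γ` commutes with `D δ_1`. It
is nonzero because every vertex is the source of a boundary path (`exists_boundary_src`), and it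
lies outside `D δ_1`. -/

namespace PrePath

/-! ### Periodic pre-paths. -/

variable {V : Type*} {E : Type*}

/-- Pre-paths that have arbitrarily long common initial segments are equal. -/
theorem eq_of_common_prefixes {x y : PrePath V E}
    (h : ∀ n, ∃ (p : List E) (x' y' : PrePath V E), n ≤ p.length ∧ x = x'.concat p ∧
      y = y'.concat p) : x = y := by
  -- A finite pre-path has no initial segment longer than its own list of edges.
  have not_fin : ∀ {z : PrePath V E}, (∀ n, ∃ (p : List E) (z' : PrePath V E), n ≤ p.length ∧
      z = z'.concat p) → ∃ ξ, z = .inf ξ := by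
    intro z hz
    cases z with
    | inf ξ => exact ⟨ξ, rfl⟩
    | fin α v =>
      obtain ⟨p, z', hp, h⟩ := hz (α.length + 1)
      cases z' with
      | inf ξ => simp [concat] at h
      | fin β w =>
        simp only [concat, fin.injEq] at h
        have := congrArg List.length h.1
        simp only [List.length_append] at this
        omega
  obtain ⟨ξ, rfl⟩ := not_fin fun n => let ⟨p, x', _, hp, hx, _⟩ := h n; ⟨p, x', hp, hx⟩
  obtain ⟨η, rfl⟩ := not_fin fun n => let ⟨p, _, y', hp, _, hy⟩ := h n; ⟨p, y', hp, hy⟩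
  refine congrArg inf (Stream'.ext fun n => ?_)
  obtain ⟨p, x', y', hp, h1, h2⟩ := h (n + 1)
  cases x' with
  | fin β w => simp [concat] at h1
  | inf ξ' =>
    cases y' with
    | fin β w => simp [concat] at h2
    | inf η' =>
      simp only [concat, inf.injEq] at h1 h2
      rw [h1, h2, Stream'.get_append_left _ _ _ hp, Stream'.get_append_left _ _ _ hp]

/-- A pre-path `y = c y` starts with arbitrarily many copies of `c`. -/
theorem concat_flatten_replicate {γ : List E} {y : PrePath V E} (h : y = y.concat γ) (k : ℕ) :
    y = y.concat (List.replicate k γ).flatten := by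
  induction k with
  | zero => exact (concat_nil y).symm
  | succ k ih => rw [List.replicate_succ, List.flatten_cons, concat_append, ← ih, ← h]

theorem le_length_flatten_replicate {γ : List E} (hγ : γ ≠ []) (k : ℕ) :
    k ≤ (List.replicate k γ).flatten.length := by
  simpa using Nat.le_mul_of_pos_right k (List.length_pos_iff.2 hγ)

/-- Both sides start with every power of `γ`. This is the source of the uniqueness of fixed points.
-/
theorem eq_of_concat_eq_self {γ : List E} (hγ : γ ≠ []) {x y : PrePath V E}
    (hx : x = x.concat γ) (hy : y = y.concat γ) : x = y :=
  eq_of_common_prefixes fun n => ⟨_, x, y, le_length_flatten_replicate hγ n,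
    concat_flatten_replicate hx n, concat_flatten_replicate hy n⟩

end PrePath

/-! ### Coefficients in a partial skew group ring. -/

namespace PartialAction

variable {Γ : Type*} {A : Type*} [Group Γ] [NonUnitalRing A] (α : PartialAction Γ A)

/-- The coefficient of `δ_t` in a formal sum. -/
noncomputable def coeff (t : Γ) : α.SkewGroupRing →+ α.dom t :=
  show (⨁ t : Γ, α.dom t) →+ α.dom t from DFinsupp.evalAddMonoidHom t

theorem coeff_ext {x y : α.SkewGroupRing} (h : ∀ t, α.coeff t x = α.coeff t y) : x = y :=
  DFinsupp.ext (β := fun t => α.dom t) h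

open Classical in
theorem coeff_single_self (t : Γ) (a : α.dom t) : α.coeff t (α.single t a) = a :=
  DirectSum.of_eq_same (β := fun t => α.dom t) t a

open Classical in
theorem coeff_single_of_ne {s t : Γ} (h : s ≠ t) (a : α.dom s) :
    α.coeff t (α.single s a) = 0 :=
  DirectSum.of_eq_of_ne (β := fun t => α.dom t) s t a h.symm

end PartialAction

namespace Ultragraph

variable {V : Type*} {E : Type*} (G : Ultragraph V E)

/-! ### Coefficients of elements of the partial skew group ring -/

section Coefficients

variable {R : Type*} [CommRing R]

/-- The coefficient of `δ_t`, as a function on the boundary path space. -/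
noncomputable def coeff (t : FreeGroup E) : G.SkewRing R →+ (G.X → R) where
  toFun x := ((G.partialAction R).coeff t x).1.1
  map_zero' := by rw [map_zero]; rfl
  map_add' x y := by rw [map_add]; rfl

variable {G}

theorem coeff_single_self (t : FreeGroup E) (a : (G.partialAction R).dom t) :
    G.coeff t ((G.partialAction R).single t a) = a.1.1 :=
  congrArg (fun z => z.1.1) ((G.partialAction R).coeff_single_self t a)

theorem coeff_single_of_ne {s t : FreeGroup E} (h : s ≠ t) (a : (G.partialAction R).dom s) :
    G.coeff t ((G.partialAction R).single s a) = 0 :=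
  congrArg (fun z => z.1.1) ((G.partialAction R).coeff_single_of_ne h a)

theorem coeff_mem (x : G.SkewRing R) (t : FreeGroup E) : G.coeff t x ∈ G.D R :=
  ((G.partialAction R).coeff t x).1.2

theorem coeff_ext {x y : G.SkewRing R} (h : ∀ t, G.coeff t x = G.coeff t y) : x = y :=
  (G.partialAction R).coeff_ext fun t => Subtype.ext (Subtype.ext (h t))

theorem coeff_apply_not_mem (x : G.SkewRing R) {t : FreeGroup E} {u : G.X} (h : u ∉ G.cyl t) :
    G.coeff t x u = 0 :=
  G.mem_Dt_iff.1 ((G.partialAction R).coeff t x).2 u h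

/-- `β_1` is the identity, so multiplication by `f δ_1` from the left is pointwise on every
coefficient. -/
theorem coeff_single_one_mul (f : (G.partialAction R).dom 1) (x : G.SkewRing R)
    (t : FreeGroup E) (u : G.X) :
    G.coeff t ((G.partialAction R).single 1 f * x) u = f.1.1 u * G.coeff t x u := by
  induction x using (G.partialAction R).skew_induction with
  | h0 => simp
  | ha x y hx hy => simp only [mul_add, map_add, Pi.add_apply, hx, hy]
  | hs s a =>
    rw [PartialAction.single_mul_single]
    by_cases h : s = t
    · subst h
      rw [coeff_single_self]
      -- The product sits in degree `1 * s`, equal to `s` only propositionally; generalizing the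
      -- degree lets the equality be substituted.
      have key : ∀ s' (h : s' = s) (b : (G.partialAction R).dom s'),
          G.coeff s ((G.partialAction R).single s' b) = b.1.1 := by
        rintro s' rfl b
        exact coeff_single_self _ b
      rw [key _ (one_mul s), G.mulAux_apply _ _ (G.moves_one.2 rfl)]
    · rw [coeff_single_of_ne h, coeff_single_of_ne (by rwa [one_mul])]
      simp

/-- From the right, `f` is transported by `β_t`, so it is evaluated at the preimage `w` of `u` under
`θ_t`. The contrast with multiplication from the left yields the commutation criterion. -/
theorem coeff_mul_single_one (f : (G.partialAction R).dom 1) (x : G.SkewRing R)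
    {t : FreeGroup E} {w u : G.X} (hwu : G.Moves t w u) :
    G.coeff t (x * (G.partialAction R).single 1 f) u = G.coeff t x u * f.1.1 w := by
  induction x using (G.partialAction R).skew_induction with
  | h0 => simp
  | ha x y hx hy => simp only [add_mul, map_add, Pi.add_apply, hx, hy]
  | hs s a =>
    rw [PartialAction.single_mul_single]
    by_cases h : s = t
    · subst h
      rw [coeff_single_self]
      have key : ∀ s' (h : s' = s) (b : (G.partialAction R).dom s'),
          G.coeff s ((G.partialAction R).single s' b) = b.1.1 := by
        rintro s' rfl b
        exact coeff_single_self _ b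
      rw [key _ (mul_one s), G.mulAux_apply _ _ hwu]
    · rw [coeff_single_of_ne h, coeff_single_of_ne (by rwa [mul_one])]
      simp

/-- The element of `D_1 = D` given by an element of `D`. -/
def toDomOne {f : G.X → R} (hf : f ∈ G.D R) : (G.partialAction R).dom 1 :=
  ⟨⟨f, hf⟩, by rw [(G.partialAction R).dom_one]; trivial⟩

theorem mem_base_iff {x : G.SkewRing R} : x ∈ G.Dδ R ↔ ∀ t, t ≠ 1 → G.coeff t x = 0 := by
  constructor
  · rintro ⟨a, rfl⟩ t ht
    exact coeff_single_of_ne ht.symm a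
  · intro h
    refine ⟨toDomOne (coeff_mem x 1), coeff_ext fun t => ?_⟩
    by_cases ht : t = 1
    · subst ht
      rw [coeff_single_self]
      rfl
    · rw [h t ht, coeff_single_of_ne (Ne.symm ht)]

/-- An element commutes with `D δ_1` iff each of its coefficients `a_t` satisfies
`a_t f = a_t (f ∘ θ_{t⁻¹})` for all `f` in `D`. -/
theorem mem_centralizer_base_iff {x : G.SkewRing R} : x ∈ Set.centralizer (G.Dδ R) ↔
    ∀ t w u, G.Moves t w u → ∀ f ∈ G.D R, f u * G.coeff t x u = G.coeff t x u * f w := by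
  rw [Set.mem_centralizer_iff]
  constructor
  · intro h t w u hwu f hf
    have := congrArg (fun z => G.coeff t z u) (h _ ⟨toDomOne hf, rfl⟩)
    rwa [coeff_single_one_mul, coeff_mul_single_one _ _ hwu] at this
  · rintro h _ ⟨f, rfl⟩
    refine coeff_ext fun t => funext fun u => ?_
    by_cases hu : u ∈ G.cyl t
    · obtain ⟨w, hw⟩ := G.mem_cyl_iff.1 hu
      rw [coeff_single_one_mul, coeff_mul_single_one _ _ hw]
      exact h t w u hw _ f.1.2
    · rw [coeff_apply_not_mem _ hu, coeff_apply_not_mem _ hu]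

/-- Commutativity of `D` gives this inclusion for every ultragraph, so only the reverse one depends
on Condition (L). -/
theorem base_subset_centralizer : G.Dδ R ⊆ Set.centralizer (G.Dδ R) := by
  intro x hx
  rw [mem_centralizer_base_iff]
  intro t w u hwu f hf
  by_cases ht : t = 1
  · subst ht
    rw [G.moves_one.1 hwu, mul_comm]
  · rw [mem_base_iff.1 hx t ht]
    simp

end Coefficients

/-! ### Boundary paths -/

variable {G}

/-- Ranges are nonempty, so a path can be continued until it meets a sink, and forever if it never
does. -/
theorem exists_boundary_src (v : V) : ∃ y : G.X, G.src y.1 = v := by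
  by_cases h : ∃ e : E, G.s e = v
  · obtain ⟨e, rfl⟩ := h
    by_contra hne
    push Not at hne
    -- If no boundary path starts at `s(f)`, then none starts at any vertex of `r(f)`. Such a vertex
    -- is not a sink, hence emits an edge with the same defect. Iterating gives an infinite path
    -- after all.
    have step : ∀ f : {f : E // ∀ y : G.X, G.src y.1 ≠ G.s f},
        ∃ g : {f : E // ∀ y : G.X, G.src y.1 ≠ G.s f}, G.s g.1 ∈ G.r f.1 := by
      rintro ⟨f, hf⟩
      obtain ⟨w, hw⟩ := G.r_nonempty f
      have hy : ∀ y : G.X, G.src y.1 ≠ w := by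
        rintro y rfl
        exact hf ⟨y.1.concat [f], (G.isBoundary_concat_singleton f y.1).2 ⟨hw, y.2⟩⟩
          (G.src_concat_cons f [] y.1)
      by_cases hs : G.IsSink w
      · exact absurd rfl (hy ⟨.fin [] w, List.isChain_nil, hs, trivial⟩)
      · unfold IsSink at hs
        push Not at hs
        obtain ⟨g, rfl⟩ := hs
        exact ⟨⟨g, hy⟩, hw⟩
    choose next hnext using step
    let ξ : Stream' {f : E // ∀ y : G.X, G.src y.1 ≠ G.s f} := Stream'.iterate next ⟨e, hne⟩
    refine hne ⟨.inf (fun n => (ξ n).1), fun n => ?_⟩ rfl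
    exact (congrArg (fun g => G.s g.1 ∈ G.r (ξ n).1)
      (Stream'.get_succ_iterate' n next _)).mpr (hnext (ξ n))
  · exact ⟨⟨.fin [] v, List.isChain_nil, fun e he => h ⟨e, he⟩, trivial⟩, rfl⟩

theorem exists_concat_singleton_or_sink (x : G.X) :
    (∃ (e : E) (y : G.X), x.1 = y.1.concat [e]) ∨ ∃ v, G.IsSink v ∧ x.1 = .fin [] v := by
  obtain ⟨x, hx⟩ := x
  have key : ∀ (e : E) (y : PrePath V E), x = y.concat [e] →
      ∃ (e : E) (y : G.X), x = y.1.concat [e] := by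
    rintro e y rfl
    exact ⟨e, ⟨y, ((G.isBoundary_concat_singleton e y).1 hx).2⟩, rfl⟩
  match x, hx, key with
  | .inf ξ, _, key =>
    refine Or.inl (key ξ.head (.inf ξ.tail) ?_)
    simp only [PrePath.concat, Stream'.cons_append_stream, Stream'.nil_append_stream]
    rw [Stream'.eta]
  | .fin (e :: α) v, _, key => exact Or.inl (key e (.fin α v) rfl)
  | .fin [] v, hx, _ => exact Or.inr ⟨v, hx.2.1, rfl⟩

variable {R : Type*} [CommRing R]

/-! ### Elements of `D` depend on finitely many edges and separate points -/

/-- A segment `p` strictly longer than `b` also shows the edge after `b`, and the source of that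
edge is the vertex tested against `A`. With equal lengths the answer would depend on `z`. -/
theorem exists_concat_eq_iff {p b : List E} (hp : b.length < p.length) {z : PrePath V E}
    (hz : G.IsBoundary (z.concat p)) (A : Set V) :
    (∃ y : G.X, G.src y.1 ∈ A ∧ z.concat p = y.1.concat b) ↔
      ∃ e q, p = b ++ e :: q ∧ G.s e ∈ A := by
  constructor
  · rintro ⟨y, hy, h⟩
    rcases PrePath.concat_comparable h with ⟨c, rfl, -⟩ | ⟨c, rfl, hc⟩
    · simp at hp
    · cases c with
      | nil => simp at hp
      | cons e q =>
        rw [hc, src_concat_cons] at hy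
        exact ⟨e, q, rfl, hy⟩
  · rintro ⟨e, q, rfl, h⟩
    rw [PrePath.concat_append] at hz ⊢
    exact ⟨⟨_, ((G.isBoundary_concat _ _).1 hz).2.2⟩, by rwa [src_concat_cons], rfl⟩

/-- The value of an element of `D` at a long enough boundary path is determined by an initial
segment of the path. -/
theorem exists_length_forall_eq {f : G.X → R} (hf : f ∈ G.D R) : ∃ n, ∀ p : List E,
    n ≤ p.length → ∀ (x x' : G.X) (z z' : PrePath V E), x.1 = z.concat p → x'.1 = z'.concat p →
      f x = f x' := by
  -- One implication suffices, since the hypotheses are symmetric in `x` and `x'`.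
  have char_case : ∀ (S : Set G.X) (n : ℕ), (∀ p : List E, n ≤ p.length → ∀ (x x' : G.X)
      (z z' : PrePath V E), x.1 = z.concat p → x'.1 = z'.concat p → (x ∈ S → x' ∈ S)) →
      ∃ n, ∀ p : List E, n ≤ p.length → ∀ (x x' : G.X) (z z' : PrePath V E),
        x.1 = z.concat p → x'.1 = z'.concat p → G.char R S x = G.char R S x' := by
    intro S n h
    refine ⟨n, fun p hp x x' z z' hx hx' => ?_⟩
    by_cases hS : x ∈ S
    · rw [G.char_apply_mem hS, G.char_apply_mem (h p hp x x' z z' hx hx' hS)]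
    · rw [G.char_apply_not_mem hS,
        G.char_apply_not_mem fun hS' => hS (h p hp x' x z' z hx' hx hS')]
  unfold D at hf
  induction hf using NonUnitalAlgebra.adjoin_induction with
  | mem g hg =>
    cases hg with
    | @vertex A hA =>
      refine char_case _ 1 fun p hp x x' z z' hx hx' h => ?_
      cases p with
      | nil => simp at hp
      | cons e p =>
        simp only [vcyl, Set.mem_ofPred_eq] at h ⊢
        rw [hx, src_concat_cons] at h
        rwa [hx', src_concat_cons]
    | @path b A hb hp hA =>
      refine char_case _ (b.length + 1) fun p hp x x' z z' hx hx' h => ?_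
      simp only [pcyl, Set.mem_ofPred_eq] at h ⊢
      rw [hx, exists_concat_eq_iff hp (hx ▸ x.2)] at h
      rwa [hx', exists_concat_eq_iff hp (hx' ▸ x'.2)]
    | @group c hc =>
      by_cases hpr : ∃ a b, G.Presents c a b
      · obtain ⟨a, b, hab⟩ := hpr
        -- For `c = a b⁻¹`, membership in `X_c` is a condition on the vertex reached after `a`,
        -- visible one edge later.
        refine char_case _ (a.length + 1) fun p hp x x' z z' hx hx' h => ?_
        obtain ⟨a', b', hab', h⟩ := h
        obtain ⟨rfl, rfl⟩ := hab.unique G hab'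
        refine ⟨a, b, hab, ?_⟩
        rw [hx, exists_concat_eq_iff hp (hx ▸ x.2)] at h
        rwa [hx', exists_concat_eq_iff hp (hx' ▸ x'.2)]
      · refine char_case _ 0 fun p hp x x' z z' hx hx' h => ?_
        obtain ⟨a, b, hab, -⟩ := h
        exact absurd ⟨a, b, hab⟩ hpr
  | add f g hf hg h1 h2 =>
    obtain ⟨n, hn⟩ := h1
    obtain ⟨m, hm⟩ := h2
    refine ⟨max n m, fun p hp x x' z z' hx hx' => ?_⟩
    rw [Pi.add_apply, Pi.add_apply, hn p (le_of_max_le_left hp) x x' z z' hx hx',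
      hm p (le_of_max_le_right hp) x x' z z' hx hx']
  | zero => exact ⟨0, fun _ _ _ _ _ _ _ _ => rfl⟩
  | mul f g hf hg h1 h2 =>
    obtain ⟨n, hn⟩ := h1
    obtain ⟨m, hm⟩ := h2
    refine ⟨max n m, fun p hp x x' z z' hx hx' => ?_⟩
    rw [Pi.mul_apply, Pi.mul_apply, hn p (le_of_max_le_left hp) x x' z z' hx hx',
      hm p (le_of_max_le_right hp) x x' z z' hx hx']
  | smul r f hf h =>
    obtain ⟨n, hn⟩ := h
    refine ⟨n, fun p hp x x' z z' hx hx' => ?_⟩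
    rw [Pi.smul_apply, Pi.smul_apply, hn p hp x x' z z' hx hx']

theorem mem_pcyl_iff_of_eq_concat {b : List E} {A : Set V} {y x : G.X} (h : x.1 = y.1.concat b) :
    x ∈ G.pcyl b A ↔ G.src y.1 ∈ A := by
  constructor
  · rintro ⟨z, hz, hx⟩
    rwa [PrePath.concat_inj (h.symm.trans hx)]
  · exact fun hA => ⟨y, hA, h⟩

/-- Unlike the generators `1_{bA}`, this allows `p` to be empty (giving `1_A`) or not a path (giving
`0`). -/
theorem char_pcyl_mem (p : List E) {A : Set V} (hA : G.IsGenVertex A) :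
    G.char R (G.pcyl p A) ∈ G.D R := by
  convert G.char_image_mem (word p) hA using 2
  ext x
  simp [moves_word, pcyl, and_comm]

/-- These paths form `X_c` for `c` the word of `p ++ [e]`; the last edge guarantees `c ≠ 1`. -/
theorem char_prefix_mem (p : List E) (e : E) :
    G.char R {x | ∃ y : G.X, x.1 = y.1.concat (p ++ [e])} ∈ G.D R := by
  have hne : word (p ++ [e]) ≠ 1 := fun h => by
    have := word_injective (h.trans word_nil.symm)
    simp at this
  convert G.gen_mem (R := R) (.group hne) using 2
  ext x
  simp [mem_cyl_iff, moves_word]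

/-- Any two distinct boundary paths are separated by a function in `D`. -/
theorem exists_mem_D_separating {x y : G.X} (hxy : x ≠ y) :
    ∃ f ∈ G.D R, f x = 1 ∧ f y = 0 ∨ f x = 0 ∧ f y = 1 := by
  by_contra hne
  have hsep : ∀ S : Set G.X, G.char R S ∈ G.D R → (x ∈ S ↔ y ∈ S) := by
    intro S hS
    by_contra hiff
    refine hne ⟨_, hS, ?_⟩
    by_cases hx : x ∈ S
    · have hy : y ∉ S := fun hy => hiff (iff_of_true hx hy)
      exact Or.inl ⟨G.char_apply_mem hx, G.char_apply_not_mem hy⟩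
    · have hy : y ∈ S := by_contra fun hy => hiff (iff_of_false hx hy)
      exact Or.inr ⟨G.char_apply_not_mem hx, G.char_apply_mem hy⟩
  -- After a common segment `p`, the functions `1_{p{v}}` force equal sources of the remainders, and
  -- the functions `1_{pe}` force equal next edges. So unseparated paths agree edge by edge, or end
  -- together at the same sink.
  have step : ∀ (p : List E) (x' y' : G.X), x.1 = x'.1.concat p → y.1 = y'.1.concat p →
      (∃ (e : E) (x'' y'' : G.X), x'.1 = x''.1.concat [e] ∧ y'.1 = y''.1.concat [e]) ∨
        (∃ v, x'.1 = .fin [] v ∧ y'.1 = .fin [] v) := by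
    intro p x' y' hx hy
    have hsrc : G.src x'.1 = G.src y'.1 := by
      have := hsep _ (char_pcyl_mem p (.singleton (G.src x'.1)))
      rw [mem_pcyl_iff_of_eq_concat hx, mem_pcyl_iff_of_eq_concat hy] at this
      exact (this.1 rfl).symm
    rcases exists_concat_singleton_or_sink x' with ⟨e, x'', hx''⟩ | ⟨v, hv, hx'v⟩
    · have := (hsep _ (char_prefix_mem p e)).1
        ⟨x'', by rw [hx, hx'', PrePath.concat_append]⟩
      obtain ⟨y'', hy''⟩ := this
      rw [hy, PrePath.concat_append] at hy''
      exact Or.inl ⟨e, x'', y'', hx'', PrePath.concat_inj hy''⟩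
    · rcases exists_concat_singleton_or_sink y' with ⟨e, y'', hy''⟩ | ⟨w, hw, hyw⟩
      · rw [hx'v, hy'', src_concat_cons] at hsrc
        exact absurd hsrc.symm (hv e)
      · rw [hx'v, hyw] at hsrc
        obtain rfl : v = w := hsrc
        exact Or.inr ⟨v, hx'v, hyw⟩
  refine hxy (Subtype.ext (PrePath.eq_of_common_prefixes fun n => ?_))
  suffices ∃ (p : List E) (x' y' : G.X), n ≤ p.length ∧ x.1 = x'.1.concat p ∧
      y.1 = y'.1.concat p by
    obtain ⟨p, x', y', h⟩ := this
    exact ⟨p, x'.1, y'.1, h⟩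
  induction n with
  | zero => exact ⟨[], x, y, le_rfl, (PrePath.concat_nil _).symm, (PrePath.concat_nil _).symm⟩
  | succ n ih =>
    obtain ⟨p, x', y', hp, hx, hy⟩ := ih
    rcases step p x' y' hx hy with ⟨e, x'', y'', hx'', hy''⟩ | ⟨v, hxv, hyv⟩
    · refine ⟨p ++ [e], x'', y'', by simp [hp], ?_, ?_⟩
      · rw [hx, hx'', PrePath.concat_append]
      · rw [hy, hy'', PrePath.concat_append]
    · exact absurd (Subtype.ext (by rw [hx, hy, hxv, hyv])) hxy

/-- The coefficients of an element that commutes with `D δ_1` are supported on fixed points. -/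
theorem coeff_eq_zero_of_mem_centralizer {x : G.SkewRing R}
    (hx : x ∈ Set.centralizer (G.Dδ R)) {t : FreeGroup E} {w u : G.X} (hwu : G.Moves t w u)
    (hne : w ≠ u) : G.coeff t x u = 0 := by
  obtain ⟨f, hf, ⟨hw, hu⟩ | ⟨hw, hu⟩⟩ := exists_mem_D_separating (R := R) hne <;>
  · have := mem_centralizer_base_iff.1 hx t w u hwu f hf
    rw [hw, hu] at this
    simpa [eq_comm] using this

/-! ### Cycles and periodic paths -/

/-- A cycle without exits whose ranges contain no sinks can be continued in only one way. -/
theorem eq_of_not_hasExit {γ : List E} (hex : ¬ G.HasExit γ)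
    (hsink : ∀ e ∈ γ, ∀ v ∈ G.r e, ¬ G.IsSink v) (hγ : γ ≠ []) {y : G.X}
    (hy : G.src y.1 ∈ G.r (γ.getLast hγ)) :
    y.1 = .inf fun n => γ[n % γ.length]'(Nat.mod_lt _ (List.length_pos_iff.2 hγ)) := by
  have hlen : 0 < γ.length := List.length_pos_iff.2 hγ
  have next : ∀ (i : ℕ) (hi : i < γ.length) (e : E), G.s e ∈ G.r γ[i] →
      e = γ[(i + 1) % γ.length]'(Nat.mod_lt _ hlen) := by
    intro i hi e he
    by_contra hne
    exact hex ⟨i, hi, e, he, hne⟩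
  have next_mem : ∀ e ∈ γ, ∀ f, G.s f ∈ G.r e → f ∈ γ := by
    intro e he f hf
    obtain ⟨i, hi, rfl⟩ := List.getElem_of_mem he
    rw [next i hi f hf]
    exact List.getElem_mem _
  obtain ⟨y, hyb⟩ := y
  cases y with
  | fin α v =>
    exfalso
    -- A finite continuation stays among the edges of `γ`, so its final sink would lie in one of
    -- their ranges.
    have key : ∀ (α : List E) (e : E), e ∈ γ → G.IsBoundary (.fin α v) →
        G.src (.fin α v) ∈ G.r e → False := by
      intro α
      induction α with
      | nil => exact fun e he hb hv => hsink e he v hv hb.2.1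
      | cons f α ih =>
        intro e he hb hf
        have := (G.isBoundary_concat_singleton f (.fin α v)).1 hb
        exact ih f (next_mem e he f hf) this.2 this.1
    exact key α _ (List.getLast_mem hγ) hyb hy
  | inf ξ =>
    refine congrArg PrePath.inf (funext fun n => ?_)
    induction n with
    | zero =>
      rw [List.getLast_eq_getElem] at hy
      rw [next _ _ _ hy]
      congr 1
      rw [Nat.sub_add_cancel hlen, Nat.mod_self, Nat.zero_mod]
    | succ n ih =>
      have h := hyb n
      rw [ih] at h
      rw [next _ _ _ h]
      congr 1
      rw [Nat.mod_add_mod]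

theorem rng_append {a b : List E} (hb : b ≠ []) : G.rng (a ++ b) = G.rng b := by
  rw [rng, rng, List.getLast?_append_of_ne_nil _ hb]

/-- A boundary path `y` with `y = γ y`, for a non-empty `γ`, is infinite and `γ` is a cycle. -/
theorem isCycle_of_concat_eq_self {γ : List E} (hγ : γ ≠ []) {y : G.X}
    (hy : y.1 = y.1.concat γ) : G.IsCycle γ := by
  have hb := (G.isBoundary_concat γ y.1).1 (hy ▸ y.2)
  refine ⟨hb.1, hγ, ?_⟩
  obtain ⟨e, γ', rfl⟩ := List.exists_cons_of_ne_nil hγ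
  have h2 := hb.2.1
  rw [hy, src_concat_cons] at h2
  simpa [rng, List.getLast?_eq_getLast_of_ne_nil] using h2

/-- If `y = γ y` and the cycle `γ` has an exit or meets a sink, then after arbitrarily many turns
another path leaves `y`. -/
theorem exists_ne_of_concat_eq_self (hL : G.ConditionL) {γ : List E} (hγ : γ ≠ []) {y : G.X}
    (hy : y.1 = y.1.concat γ) (n : ℕ) : ∃ (p : List E) (z z' : G.X), n ≤ p.length ∧
      y.1 = z.1.concat p ∧ G.src z'.1 ∈ G.rng p ∧ z ≠ z' := by
  have hlen : 0 < γ.length := List.length_pos_iff.2 hγ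
  obtain ⟨ξ, hξ⟩ : ∃ ξ, y.1 = .inf ξ := by
    obtain ⟨y, hyb⟩ := y
    cases y with
    | inf ξ => exact ⟨ξ, rfl⟩
    | fin α v =>
      simp only [PrePath.concat, PrePath.fin.injEq, and_true] at hy
      exact absurd (by simpa using congrArg List.length hy) hγ
  have hyq := PrePath.concat_flatten_replicate hy n
  have hq := PrePath.le_length_flatten_replicate hγ n
  set q := (List.replicate n γ).flatten
  -- Cut `y` after `n` turns and `i + 1` further edges. The remainder `z` is written with one whole
  -- extra copy of `γ`, so that its first edge is visible even when the cut falls at the end of `γ`.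
  have split : ∀ (i : ℕ) (hi : i < γ.length), ∃ (p : List E) (z : G.X), n ≤ p.length ∧
      y.1 = z.1.concat p ∧ G.rng p = G.r γ[i] ∧
      z.1 = (y.1.concat γ).concat (γ.drop (i + 1)) := by
    intro i hi
    have h1 : y.1.concat (q ++ γ.take (i + 1) ++ γ.drop (i + 1) ++ γ) = y.1 := by
      rw [PrePath.concat_append, ← hy, List.append_assoc, List.take_append_drop,
        PrePath.concat_append, ← hy, ← hyq]
    rw [PrePath.concat_append, PrePath.concat_append] at h1
    have hb := y.2
    rw [← h1] at hb
    refine ⟨q ++ γ.take (i + 1), ⟨_, ((G.isBoundary_concat _ _).1 hb).2.2⟩, ?_, h1.symm, ?_, rfl⟩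
    · simp; omega
    · have : (γ.take (i + 1)).getLast? = some γ[i] := by
        rw [← List.take_append_getElem hi, List.getLast?_concat]
      rw [rng_append (by rintro h; simp [h] at this), rng, this]
  rcases hL γ (isCycle_of_concat_eq_self hγ hy) with ⟨i, hi, e, he, hne⟩ | ⟨e, he, v, hv, hs⟩
  · obtain ⟨p, z, hp, hyz, hr, hz⟩ := split i hi
    obtain ⟨w, hw⟩ := G.r_nonempty e
    obtain ⟨z', hz'⟩ := exists_boundary_src (G := G) w
    -- The second path takes the exit `e` and continues arbitrarily; its first edge differs from
    -- that of `z`.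
    refine ⟨p, z, ⟨z'.1.concat [e], (G.isBoundary_concat_singleton e _).2 ⟨hz' ▸ hw, z'.2⟩⟩,
      hp, hyz, ?_, ?_⟩
    · rw [hr, src_concat_cons]
      exact he
    · rintro rfl
      have hfirst : ∃ q, γ.drop (i + 1) ++ γ = γ[(i + 1) % γ.length]'(Nat.mod_lt _ hlen) :: q := by
        by_cases h : i + 1 < γ.length
        · rw [List.drop_eq_getElem_cons h]
          simp only [Nat.mod_eq_of_lt h]
          exact ⟨_, rfl⟩
        · obtain h : i + 1 = γ.length := by omega
          simp only [h, Nat.mod_self, List.drop_length, List.nil_append]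
          exact ⟨γ.tail, by rw [← List.head_eq_getElem hγ, List.cons_head_tail]⟩
      obtain ⟨q, hq⟩ := hfirst
      simp only at hz
      rw [← PrePath.concat_append, hq, ← List.singleton_append (l := q), PrePath.concat_append] at hz
      exact hne (PrePath.concat_cons_inj hz).1
  · obtain ⟨i, hi, rfl⟩ := List.getElem_of_mem he
    obtain ⟨p, z, hp, hyz, hr, hz⟩ := split i hi
    -- Here the second path stops at the sink, whereas `z` is infinite.
    refine ⟨p, z, ⟨.fin [] v, List.isChain_nil, hs, trivial⟩, hp, hyz, ?_, ?_⟩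
    · rw [hr]
      exact hv
    · rintro rfl
      simp only at hz
      rw [hξ] at hz
      simp [PrePath.concat] at hz

/-- A fixed point of `θ_t`, `t ≠ 1`, has the form `b y` with `y = γ y` and `γ` not empty, and it
is the only fixed point of `θ_t`. -/
theorem Moves.exists_of_fixed {t : FreeGroup E} (ht : t ≠ 1) {x : G.X} (h : G.Moves t x x) :
    ∃ (b γ : List E) (y : G.X), γ ≠ [] ∧ x.1 = y.1.concat b ∧ y.1 = y.1.concat γ ∧
      ∀ x' : G.X, G.Moves t x' x' → x' = x := by
  obtain ⟨a, b, hab, y, hb, ha⟩ := h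
  have hne : a ≠ b := by
    rintro rfl
    exact ht (by rw [← hab.2.2.2, mul_inv_cancel])
  -- From `a y = b y` one of `a`, `b` extends the other by some `γ`, and cancelling gives `y = γ y`.
  -- By uniqueness of the reduced form any other fixed point has the same `a`, `b`, hence the same
  -- `γ` and the same tail.
  rcases PrePath.concat_comparable (ha.symm.trans hb) with ⟨γ, rfl, hγ⟩ | ⟨γ, rfl, hγ⟩
  · have hγ0 : γ ≠ [] := fun h => hne (by simp [h])
    refine ⟨a, γ, y, hγ0, ha, hγ, ?_⟩
    rintro x' ⟨a', b', hab', y', hb', ha'⟩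
    obtain ⟨rfl, rfl⟩ := hab.unique G hab'
    have hy' := PrePath.concat_inj (((PrePath.concat_append _ _ _).symm.trans hb'.symm).trans ha')
    refine Subtype.ext ?_
    rw [ha, ha', PrePath.eq_of_concat_eq_self hγ0 hγ hy'.symm]
  · have hγ0 : γ ≠ [] := fun h => hne (by simp [h])
    refine ⟨b, γ, y, hγ0, hb, hγ, ?_⟩
    rintro x' ⟨a', b', hab', y', hb', ha'⟩
    obtain ⟨rfl, rfl⟩ := hab.unique G hab'
    have hy' := PrePath.concat_inj (((PrePath.concat_append _ _ _).symm.trans ha'.symm).trans hb')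
    refine Subtype.ext ?_
    rw [hb, hb', PrePath.eq_of_concat_eq_self hγ0 hγ hy'.symm]

/-! ### Maximal commutativity -/

theorem isMaximalCommutative_of_conditionL (hL : G.ConditionL) :
    IsMaximalCommutative (G.Dδ R) := by
  refine Set.Subset.antisymm (fun x hx => mem_base_iff.2 fun t ht => ?_)
    base_subset_centralizer
  funext u
  by_contra hu
  change G.coeff t x u ≠ 0 at hu
  have fixed : ∀ u, G.coeff t x u ≠ 0 → G.Moves t u u := by
    intro u hu
    obtain ⟨w, hw⟩ := G.mem_cyl_iff.1 (by_contra fun h => hu (coeff_apply_not_mem x h))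
    by_contra hne
    exact hu (coeff_eq_zero_of_mem_centralizer hx hw (by rintro rfl; exact hne hw))
  obtain ⟨b, γ, y, hγ, hb, hy, huniq⟩ := (fixed u hu).exists_of_fixed ht
  obtain ⟨n, hn⟩ := exists_length_forall_eq (coeff_mem x t)
  -- `n + 1` rather than `n` makes `p` nonempty, so that `b ++ p` has the range of `p`.
  obtain ⟨p, z, z', hp, hz, hsrc, hne⟩ := exists_ne_of_concat_eq_self hL hγ hy (n + 1)
  rw [hz, ← PrePath.concat_append] at hb
  have hp0 : p ≠ [] := by
    rintro rfl
    simp at hp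
  have hu' : G.IsBoundary (z'.1.concat (b ++ p)) := (G.isBoundary_concat _ _).2
    ⟨((G.isBoundary_concat _ _).1 (hb ▸ u.2)).1, by rwa [rng_append hp0], z'.2⟩
  have heq := hn (b ++ p) (by simp; omega) u ⟨_, hu'⟩ z.1 z'.1 hb rfl
  -- The coefficient takes the same nonzero value at `b p z'` as at `u = b p z`, so `b p z'` is also
  -- a fixed point.
  have := huniq ⟨_, hu'⟩ (fixed _ (heq ▸ hu))
  exact hne (Subtype.ext (PrePath.concat_inj (hb.symm.trans (congrArg Subtype.val this).symm)))

theorem conditionL_of_isMaximalCommutative [Nontrivial R]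
    (h : IsMaximalCommutative (G.Dδ R)) : G.ConditionL := by
  rintro γ ⟨hpath, hγ, hcyc⟩
  by_contra hne
  push Not at hne
  obtain ⟨hex, hsink⟩ := hne
  have ht : word γ ≠ 1 := fun h => hγ (word_injective (h.trans word_nil.symm))
  have huniq : ∀ y y' : G.X, G.src y.1 ∈ G.rng γ → G.src y'.1 ∈ G.rng γ → y = y' := by
    intro y y' hy hy'
    rw [rng, List.getLast?_eq_some_getLast hγ] at hy hy'
    exact Subtype.ext ((eq_of_not_hasExit hex hsink hγ hy).trans
      (eq_of_not_hasExit hex hsink hγ hy').symm)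
  -- Here `u = γ w`. The source of `w` lies in `r(γ)`, and so does that of `u` because `γ` is a
  -- cycle; only one boundary path has this property.
  have hfix : ∀ w u : G.X, G.Moves (word γ) w u → w = u := by
    intro w u hwu
    have hu := moves_word G |>.1 hwu
    refine huniq w u ((G.isBoundary_concat γ w.1).1 (hu ▸ u.2)).2.1 ?_
    rw [rng, List.getLast?_eq_some_getLast hγ, hu]
    obtain ⟨e, γ', rfl⟩ := List.exists_cons_of_ne_nil hγ
    rw [src_concat_cons]
    exact hcyc
  have hmem : G.char R (G.cyl (word γ)) ∈ G.D R := G.gen_mem (.group ht)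
  let a : (G.partialAction R).dom (word γ) :=
    ⟨⟨_, hmem⟩, G.mem_Dt_iff.2 fun x hx => G.char_apply_not_mem hx⟩
  have hbase : (G.partialAction R).single (word γ) a ∈ G.Dδ R := by
    rw [← h, mem_centralizer_base_iff]
    intro t w u hwu f hf
    by_cases htγ : word γ = t
    · subst htγ
      rw [hfix w u hwu, mul_comm]
    · rw [coeff_single_of_ne htγ]
      simp
  -- A point `γ y` of `X_γ`, where `1_γ` has the value `1 ≠ 0`.
  obtain ⟨y, hy⟩ := exists_boundary_src (G := G) (G.s (γ.head hγ))
  have hyb : G.IsBoundary (y.1.concat γ) := (G.isBoundary_concat _ _).2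
    ⟨hpath, by rw [rng, List.getLast?_eq_some_getLast hγ, hy]; exact hcyc, y.2⟩
  have h0 := congrFun (mem_base_iff.1 hbase _ ht) ⟨_, hyb⟩
  rw [coeff_single_self] at h0
  refine one_ne_zero (α := R) (Eq.trans ?_ h0)
  exact (G.char_apply_mem (G.mem_cyl_iff.2 ⟨y, (moves_word G).2 rfl⟩)).symm

end Ultragraph

theorem mainTheorem3 {V : Type*} {E : Type*} [Countable V] [Countable E]
    (G : Ultragraph V E) (R : Type*) [CommRing R] [Nontrivial R] :
    IsMaximalCommutative (G.Dδ R) ↔ G.ConditionL :=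
  ⟨Ultragraph.conditionL_of_isMaximalCommutative, Ultragraph.isMaximalCommutative_of_conditionL⟩
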